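/- Let $m\ge 2$ be an integer, and for $s\in\{m,2m\}$ let $\mathrm{Tr}_s:\mathbb F_{3^s}\to\mathbb F_3$ be the trace map. Words of length $3^{2m}$ over $\mathbb F_3$ are indexed by $t\in\mathbb F_{3^{2m}}$, and a function $f:\mathbb F_{3^{2m}}\to\mathbb F_3$ is identified with the word $(f(t))_{t}$. A linear code of this length is called affine-invariant if it is invariant under all coordinate permutations $t\mapsto s_1t+s_2$ with $s_1\in\mathbb F_{3^{2m}}^*$, $s_2\in\mathbb F_{3^{2m}}$. Consider the ternary linear code $$\mathcal C(2m,3)=\left\{\left(\mathrm{Tr}_{2m}(at^{3^m+1}+bt)+h\right)_{t\in\mathbb F_{3^{2m}}}: a\in\mathbb F_{3^m},\ b\in\mathbb F_{3^{2m}},\ h\in\mathbb F_3\right\}.$$ It is affine-invariant, and the supports of its codewords of minimum (nonzero) weight $d$ are the blocks of a $2$-design $\mathbb D_d(\mathcal C(2m,3))$ with point set $\mathbb F_{3^{2m}}$. Let $\mathcal C_3(\mathbb D_d(\mathcal C(2m,3)))$ be the code over $\mathbb F_3$ spanned by the rows of the incidence matrix of this design (rows indexed by blocks, columns by points). Then $\mathcal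 C_3(\mathbb D_d(\mathcal C(2m,3)))$ is spanned over $\mathbb F_3$ by $$\left\{\begin{matrix}\displaystyle\sum_{i=0}^{m-1}\mathrm{Tr}_{2m}\big(b_it^{(3^m+1)3^i+1}\big)+\sum_{i=0}^{2m-1}\mathrm{Tr}_{2m}\big(b_i't^{3^i+1}\big)+\sum_{i=0}^{m-1}\mathrm{Tr}_{m}\big(c_it^{(3^m+1)(3^i+1)}\big)+\mathrm{Tr}_{2m}(bt)+h:\\ b,b_i,b_i'\in\mathbb F_{3^{2m}},\ c_i\in\mathbb F_{3^m},\ h\in\mathbb F_3\end{matrix}\right\}.$$ Moreover, $\mathcal C_3(\mathbb D_d(\mathcal C(2m,3)))$ is affine-invariant, and it holds $2$-designs: for every $k\geq 1$ for which it has a codeword of Hamming weight $k$, the set of supports of its codewords of weight $k$ is the block set of a $2$-$(3^{2m},k,\lambda)$ design for some $\lambda\ge 1$ (in particular $k\ge 2$). -/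

import Mathlib

noncomputable section

namespace HermitianDesign

/-! ### Codes and designs on a finite point set -/

section General

variable {P : Type*} [Fintype P]

/-- The support of a ternary word whose coordinates are indexed by `P`. -/
def wordSupport (c : P → ZMod 3) : Finset P :=
  Finset.univ.filter fun x => c x ≠ 0

/-- The set of (distinct) supports of the codewords of Hamming weight `k` of a ternary code. -/
def supportBlocks (C : Submodule (ZMod 3) (P → ZMod 3)) (k : ℕ) : Set (Finset P) :=
  {B | ∃ c ∈ C, hammingNorm c = k ∧ B = wordSupport c}

/-- The minimum weight of a (nonzero) ternary linear code. -/
def minWeight (C : Submodule (ZMod 3) (P → ZMod 3)) : ℕ :=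
  sInf {w | ∃ c ∈ C, c ≠ 0 ∧ hammingNorm c = w}

/-- `(P, 𝓑)` is a `t`-`(|P|, k, l)` design: `1 ≤ t ≤ k ≤ |P|`, `l ≥ 1`, all blocks have size `k`,
and every `t`-subset of `P` is contained in exactly `l` blocks. -/
structure IsDesign (t k l : ℕ) (𝓑 : Set (Finset P)) : Prop where
  one_le_t : 1 ≤ t
  t_le_k : t ≤ k
  k_le_card : k ≤ Fintype.card P
  l_pos : 0 < l
  card_block : ∀ B ∈ 𝓑, B.card = k
  card_through : ∀ T : Finset P, T.card = t → {B | B ∈ 𝓑 ∧ T ⊆ B}.ncard = l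

/-- A ternary code holds `t`-designs: for every nonzero weight `k` that occurs in the code, the
supports of the codewords of weight `k` are the blocks of a `t`-design. -/
def HoldsDesigns (t : ℕ) (C : Submodule (ZMod 3) (P → ZMod 3)) : Prop :=
  ∀ k : ℕ, 0 < k → (∃ c ∈ C, hammingNorm c = k) → ∃ l, IsDesign t k l (supportBlocks C k)

open Classical in
/-- The incidence matrix over `𝔽₃`, with rows indexed by blocks and columns by points. -/
def incidenceMatrix (𝓑 : Set (Finset P)) : Matrix 𝓑 P (ZMod 3) :=
  Matrix.of fun B x => if x ∈ B.1 then 1 else 0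

/-- The ternary code spanned by the rows of the incidence matrix. -/
def designCode (𝓑 : Set (Finset P)) : Submodule (ZMod 3) (P → ZMod 3) :=
  Submodule.span (ZMod 3) (Set.range (incidenceMatrix 𝓑).row)

end General

section Field

variable {K : Type*} [Field K]

/-- A code with coordinates indexed by a finite field is affine-invariant if it is invariant under
all coordinate permutations `x ↦ s₁ x + s₂` with `s₁ ≠ 0`. -/
def AffineInvariant (C : Submodule (ZMod 3) (K → ZMod 3)) : Prop :=
  ∀ s₁ s₂ : K, s₁ ≠ 0 → ∀ c ∈ C, (fun x => c (s₁ * x + s₂)) ∈ C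

variable [Algebra (ZMod 3) K]

theorem charP_three (K : Type*) [Field K] [Algebra (ZMod 3) K] : CharP K 3 :=
  charP_of_injective_algebraMap (algebraMap (ZMod 3) K).injective 3

/-- The subfield `{x | x ^ 3 ^ m = x}` of `K`, which is `𝔽_{3^m}` when `K = 𝔽_{3^{2m}}`. -/
def halfField (K : Type*) [Field K] [Algebra (ZMod 3) K] (m : ℕ) :
    IntermediateField (ZMod 3) K where
  carrier := {x | x ^ 3 ^ m = x}
  mul_mem' := by
    intro a b ha hb
    simp only [Set.mem_ofPred_eq] at *
    rw [mul_pow, ha, hb]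
  add_mem' := by
    intro a b ha hb
    have := charP_three K
    simp only [Set.mem_ofPred_eq] at *
    rw [add_pow_char_pow, ha, hb]
  algebraMap_mem' := by
    intro r
    simp only [Set.mem_ofPred_eq]
    rw [← map_pow, ZMod.pow_card_pow]
  inv_mem' := by
    intro a ha
    simp only [Set.mem_ofPred_eq] at *
    rw [inv_pow, ha]

/-- The powers `t ^ ((3 ^ m + 1) k)` lie in `𝔽_{3^m}`. -/
theorem pow_mem_halfField [Fintype K] {m : ℕ} (hK : Fintype.card K = 3 ^ (2 * m)) (t : K)
    (k : ℕ) : t ^ ((3 ^ m + 1) * k) ∈ halfField K m := by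
  change (t ^ ((3 ^ m + 1) * k)) ^ 3 ^ m = t ^ ((3 ^ m + 1) * k)
  have h : t ^ (3 ^ m * 3 ^ m) = t := by
    rw [← pow_add, ← two_mul, ← hK, FiniteField.pow_card]
  have h' : (t ^ (3 ^ m + 1)) ^ 3 ^ m = t ^ (3 ^ m + 1) := by
    rw [← pow_mul, add_mul, one_mul, pow_add, h, pow_succ, mul_comm]
  rw [pow_mul, ← pow_mul, mul_comm k, pow_mul, h']

/-- The word `c(a,b,h) = (Tr_{2m}(a t^{3^m+1} + b t) + h)_t`. -/
def hermitianWord (m : ℕ) (a : halfField K m) (b : K) (h : ZMod 3) : K → ZMod 3 :=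
  fun t => Algebra.trace (ZMod 3) K ((a : K) * t ^ (3 ^ m + 1) + b * t) + h

/-- The ternary linear code `𝒞(2m,3) = {c(a,b,h)}`. -/
def hermitianCode (K : Type*) [Field K] [Algebra (ZMod 3) K] (m : ℕ) :
    Submodule (ZMod 3) (K → ZMod 3) where
  carrier := {c | ∃ (a : halfField K m) (b : K) (h : ZMod 3), c = hermitianWord m a b h}
  add_mem' := by
    rintro _ _ ⟨a, b, h, rfl⟩ ⟨a', b', h', rfl⟩
    refine ⟨a + a', b + b', h + h', ?_⟩
    funext t
    simp only [hermitianWord, Pi.add_apply, IntermediateField.coe_add, add_mul, map_add]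
    ring
  zero_mem' := ⟨0, 0, 0, by funext t; simp [hermitianWord]⟩
  smul_mem' := by
    rintro r _ ⟨a, b, h, rfl⟩
    refine ⟨r • a, r • b, r * h, ?_⟩
    funext t
    simp only [hermitianWord, Pi.smul_apply, IntermediateField.coe_smul, smul_mul_assoc,
      ← smul_add, map_smul, smul_eq_mul]
    ring

variable [Fintype K]

/-- The blocks of `𝔻_d(𝒞(2m,3))`: the supports of the codewords of minimum weight `d`. -/
def hermitianBlocks (K : Type*) [Field K] [Algebra (ZMod 3) K] [Fintype K] (m : ℕ) :
    Set (Finset K) :=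
  supportBlocks (hermitianCode K m) (minWeight (hermitianCode K m))

/-- The evaluation word
`∑_{i<m} Tr_{2m}(bᵢ t^{(3^m+1)3^i+1}) + ∑_{i<2m} Tr_{2m}(b'ᵢ t^{3^i+1})
  + ∑_{i<m} Tr_m(cᵢ t^{(3^m+1)(3^i+1)}) + Tr_{2m}(b t) + h`. -/
def spanningWord {m : ℕ} (hK : Fintype.card K = 3 ^ (2 * m)) (b₁ : Fin m → K)
    (b₂ : Fin (2 * m) → K) (c : Fin m → halfField K m) (b : K) (h : ZMod 3) : K → ZMod 3 :=
  fun t =>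
    (∑ i : Fin m, Algebra.trace (ZMod 3) K (b₁ i * t ^ ((3 ^ m + 1) * 3 ^ (i : ℕ) + 1)))
    + (∑ i : Fin (2 * m), Algebra.trace (ZMod 3) K (b₂ i * t ^ (3 ^ (i : ℕ) + 1)))
    + (∑ i : Fin m, Algebra.trace (ZMod 3) (halfField K m)
        (c i * ⟨t ^ ((3 ^ m + 1) * (3 ^ (i : ℕ) + 1)), pow_mem_halfField hK t _⟩))
    + Algebra.trace (ZMod 3) K (b * t) + h

end Field

end HermitianDesign

end

/-!
Over `𝔽₃` the indicator of the support of a word `c` is the componentwise square `c * c`, so with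
`C = 𝒞(2m,3)` the code `D` of the design is spanned by the squares of the minimum-weight words, and
`D ≤ C * C`. Completing the square determines the weights of `C`: for `a ≠ 0` and any `b`, the word
`c(a,b,h)` has minimum weight for all but one `h ∈ 𝔽₃`. The squares of `c(a,0,1)`, over all
`a ∈ 𝔽_{3^m}`, sum to zero because for `m ≥ 2` the fibres of `a ↦ Tr_m(a y)` have sizes divisible by
`3`; the term `a = 0` is the constant word `1`, which hence lies in `D`. The parallelogram law then
puts the square of every word of `C` in `D`, and polarization gives `D = C * C`.

A product `Tr(a x) * Tr(b y)` expands into traces of the monomials `x ^ 3 ^ i * y`, and conversely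
the orthogonality of the powers of Frobenius extracts each of these from the products, which turns
`C * C` into the stated span. The `2`-transitivity of the affine group makes the supports of any
weight `k ≥ 2` a `2`-design; weight `1` does not occur in `D`, because the blocks have size
divisible by `3`, so that the coordinates of each word of `D` sum to zero.
-/

namespace HermitianDesign

/-! ### Supports, designs and componentwise squares -/

section Designs

variable {P : Type*} [Fintype P]

theorem card_wordSupport (c : P → ZMod 3) : (wordSupport c).card = hammingNorm c := rfl

theorem hammingNorm_add_card_zeros (c : P → ZMod 3) :
    hammingNorm c + (Finset.univ.filter fun x => c x = 0).card = Fintype.card P := by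
  rw [add_comm]
  exact Finset.card_filter_add_card_filter_not (s := Finset.univ) fun x => c x = 0

theorem map_wordSupport_comp (c : P → ZMod 3) (σ : Equiv.Perm P) :
    (wordSupport (c ∘ σ)).map σ.toEmbedding = wordSupport c := by
  ext x
  simp [wordSupport, Finset.mem_map_equiv]

theorem hammingNorm_comp_perm (c : P → ZMod 3) (σ : Equiv.Perm P) :
    hammingNorm (c ∘ σ) = hammingNorm c := by
  rw [← card_wordSupport, ← card_wordSupport, ← map_wordSupport_comp c σ, Finset.card_map]

theorem ncard_supportBlocks_through_map_le {C : Submodule (ZMod 3) (P → ZMod 3)}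
    {σ : Equiv.Perm P} (hσ : ∀ c ∈ C, c ∘ σ ∈ C) (k : ℕ) (T : Finset P) :
    {B | B ∈ supportBlocks C k ∧ T.map σ.toEmbedding ⊆ B}.ncard ≤
      {B | B ∈ supportBlocks C k ∧ T ⊆ B}.ncard := by
  refine Set.ncard_le_ncard_of_injOn (Finset.map σ.symm.toEmbedding) ?_
    (Finset.map_injective _).injOn (Set.toFinite _)
  rintro _ ⟨⟨c, hc, hck, rfl⟩, hT⟩
  rw [← map_wordSupport_comp c σ, Finset.map_subset_map] at hT
  have hpre : (wordSupport c).map σ.symm.toEmbedding = wordSupport (c ∘ σ) := by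
    rw [← map_wordSupport_comp c σ, Finset.map_map]
    simp
  rw [hpre]
  exact ⟨⟨_, hσ c hc, (hammingNorm_comp_perm c σ).trans hck, rfl⟩, hT⟩

theorem exists_isDesign_supportBlocks {C : Submodule (ZMod 3) (P → ZMod 3)} {t k : ℕ}
    (ht : 1 ≤ t) (htk : t ≤ k)
    (hC : ∀ T T' : Finset P, T.card = t → T'.card = t →
      ∃ σ : Equiv.Perm P, T.map σ.toEmbedding = T' ∧ ∀ c ∈ C, c ∘ σ ∈ C)
    (hk : ∃ c ∈ C, hammingNorm c = k) :
    ∃ l, IsDesign t k l (supportBlocks C k) := by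
  obtain ⟨c, hc, hck⟩ := hk
  obtain ⟨T, hTc, hT⟩ := Finset.exists_subset_card_eq (htk.trans_eq hck.symm)
  have hle : ∀ T T' : Finset P, T.card = t → T'.card = t →
      {B | B ∈ supportBlocks C k ∧ T' ⊆ B}.ncard ≤ {B | B ∈ supportBlocks C k ∧ T ⊆ B}.ncard := by
    intro T T' hT hT'
    obtain ⟨σ, rfl, hσ⟩ := hC T T' hT hT'
    exact ncard_supportBlocks_through_map_le hσ k T
  exact ⟨{B | B ∈ supportBlocks C k ∧ T ⊆ B}.ncard,
    { one_le_t := ht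
      t_le_k := htk
      k_le_card := hck ▸ hammingNorm_le_card_fintype
      l_pos := (Set.ncard_pos (Set.toFinite _)).2 ⟨_, ⟨c, hc, hck, rfl⟩, hTc⟩
      card_block := by rintro _ ⟨c', _, hk', rfl⟩; exact hk'
      card_through := fun T' hT' => le_antisymm (hle T T' hT hT') (hle T' T hT' hT) }⟩

theorem incidenceMatrix_row (𝓑 : Set (Finset P)) (B : 𝓑) {c : P → ZMod 3}
    (hB : (B : Finset P) = wordSupport c) : (incidenceMatrix 𝓑).row B = c * c := by
  have indicator_eq_sq : ∀ x : ZMod 3, (if x ≠ 0 then 1 else 0) = x * x := by decide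
  funext x
  rw [Pi.mul_apply, ← indicator_eq_sq]
  simp [incidenceMatrix, hB, wordSupport]

theorem mul_self_mem_designCode {C : Submodule (ZMod 3) (P → ZMod 3)} {k : ℕ} {c : P → ZMod 3}
    (hc : c ∈ C) (hk : hammingNorm c = k) : c * c ∈ designCode (supportBlocks C k) :=
  Submodule.subset_span ⟨⟨wordSupport c, c, hc, hk, rfl⟩, incidenceMatrix_row _ _ rfl⟩

theorem designCode_supportBlocks_le (C : Submodule (ZMod 3) (P → ZMod 3)) (k : ℕ) :
    designCode (supportBlocks C k) ≤ C * C := by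
  refine Submodule.span_le.2 ?_
  rintro _ ⟨⟨B, c, hc, hk, hB⟩, rfl⟩
  rw [incidenceMatrix_row _ _ hB]
  exact Submodule.mul_mem_mul hc hc

theorem sum_eq_zero_of_mem_designCode {𝓑 : Set (Finset P)} (h𝓑 : ∀ B ∈ 𝓑, 3 ∣ B.card)
    {c : P → ZMod 3} (hc : c ∈ designCode 𝓑) : ∑ x, c x = 0 := by
  induction hc using Submodule.span_induction with
  | mem c hc =>
    obtain ⟨⟨B, hB⟩, rfl⟩ := hc
    simpa [incidenceMatrix, Matrix.row] using (ZMod.natCast_eq_zero_iff B.card 3).2 (h𝓑 B hB)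
  | zero => simp
  | add u v _ _ hu hv => simp [Finset.sum_add_distrib, hu, hv]
  | smul r u _ hu => simp [← Finset.mul_sum, hu]

theorem hammingNorm_ne_one_of_sum_eq_zero {c : P → ZMod 3} (hc : ∑ x, c x = 0) :
    hammingNorm c ≠ 1 := by
  rw [← card_wordSupport, ne_eq, Finset.card_eq_one]
  rintro ⟨x, hx⟩
  have ne_zero_iff : ∀ y, c y ≠ 0 ↔ y = x := fun y => by
    simpa [wordSupport] using Finset.ext_iff.1 hx y
  rw [Fintype.sum_eq_single x fun y hy => not_not.1 (mt (ne_zero_iff y).1 hy)] at hc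
  exact (ne_zero_iff x).2 rfl hc

end Designs

section AffineInvariant

variable {K : Type*} [Field K]

theorem AffineInvariant.mul {C C' : Submodule (ZMod 3) (K → ZMod 3)} (hC : AffineInvariant C)
    (hC' : AffineInvariant C') : AffineInvariant (C * C') := by
  intro s₁ s₂ hs c hc
  induction hc using Submodule.mul_induction_on' with
  | mem_mul_mem u hu v hv => exact Submodule.mul_mem_mul (hC s₁ s₂ hs u hu) (hC' s₁ s₂ hs v hv)
  | add u _ v _ hu hv => exact add_mem hu hv

theorem exists_affine_map_pair {x y x' y' : K} (h : x ≠ y) (h' : x' ≠ y') :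
    ∃ s₁ s₂ : K, s₁ ≠ 0 ∧ s₁ * x + s₂ = x' ∧ s₁ * y + s₂ = y' := by
  have hxy : x - y ≠ 0 := sub_ne_zero.2 h
  exact ⟨(x' - y') / (x - y), x' - (x' - y') / (x - y) * x,
    div_ne_zero (sub_ne_zero.2 h') hxy, by ring, by field_simp; ring⟩

theorem AffineInvariant.exists_isDesign [Fintype K] {C : Submodule (ZMod 3) (K → ZMod 3)}
    (hC : AffineInvariant C) {k : ℕ} (hk : 2 ≤ k) (hex : ∃ c ∈ C, hammingNorm c = k) :
    ∃ l, IsDesign 2 k l (supportBlocks C k) := by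
  classical
  refine exists_isDesign_supportBlocks one_le_two hk (fun T T' hT hT' => ?_) hex
  obtain ⟨x, y, hxy, rfl⟩ := Finset.card_eq_two.1 hT
  obtain ⟨x', y', hxy', rfl⟩ := Finset.card_eq_two.1 hT'
  obtain ⟨s₁, s₂, hs, rfl, rfl⟩ := exists_affine_map_pair hxy hxy'
  exact ⟨(Equiv.mulLeft₀ s₁ hs).trans (Equiv.addRight s₂), by simp [Finset.map_insert],
    hC s₁ s₂ hs⟩

end AffineInvariant

section Squares

variable {R A : Type*} [CommRing R] [CommRing A] [Algebra R A] {D : Submodule R A}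

theorem mul_self_mem_of_parallelogram (h2 : IsUnit (2 : R)) {x y : A} (hx : x * x ∈ D)
    (hadd : (x + y) * (x + y) ∈ D) (hsub : (x - y) * (x - y) ∈ D) : y * y ∈ D := by
  rw [← D.smul_mem_iff_of_isUnit h2]
  have parallelogram : (2 : R) • (y * y) =
      (x + y) * (x + y) + (x - y) * (x - y) - (2 : R) • (x * x) := by
    simp only [ofNat_smul_eq_nsmul]
    ring
  rw [parallelogram]
  exact sub_mem (add_mem hadd hsub) (D.smul_mem 2 hx)

theorem mul_self_add_algebraMap_mem (h2 : IsUnit (2 : R)) {g : A} (h1 : 1 ∈ D)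
    (hadd : (g + 1) * (g + 1) ∈ D) (hsub : (g - 1) * (g - 1) ∈ D) (r : R) :
    (g + algebraMap R A r) * (g + algebraMap R A r) ∈ D := by
  have hgg : g * g ∈ D := mul_self_mem_of_parallelogram h2 (x := 1) (by simpa using h1)
    (by simpa [add_comm] using hadd) (by convert hsub using 1; ring)
  have hg : g ∈ D := by
    rw [← D.smul_mem_iff_of_isUnit h2]
    convert sub_mem (sub_mem hadd hgg) h1 using 1
    rw [ofNat_smul_eq_nsmul]
    ring
  convert add_mem (add_mem hgg (D.smul_mem (2 * r) hg)) (D.smul_mem (r * r) h1) using 1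
  simp only [Algebra.smul_def, map_mul, map_ofNat]
  ring

theorem mul_self_le_of_forall_mul_self_mem (h2 : IsUnit (2 : R)) {C : Submodule R A}
    (hC : ∀ c ∈ C, c * c ∈ D) : C * C ≤ D := by
  refine Submodule.mul_le.2 fun u hu v hv => (D.smul_mem_iff_of_isUnit h2).1 ?_
  convert sub_mem (sub_mem (hC _ (add_mem hu hv)) (hC u hu)) (hC v hv) using 1
  rw [ofNat_smul_eq_nsmul]
  ring

end Squares

/-! ### Trace codes and their products -/

section LinearForms

variable {k V : Type*} [Field k] [Fintype k] [AddCommGroup V] [Module k V] [Fintype V]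

theorem card_mul_card_fiber [DecidableEq k] {f : V →ₗ[k] k} (hf : f ≠ 0) (c : k) :
    Fintype.card k * (Finset.univ.filter fun v => f v = c).card = Fintype.card V := by
  have hsurj := LinearMap.surjective hf
  have hsum := Finset.card_eq_sum_card_fiberwise (s := (Finset.univ : Finset V))
    (t := Finset.univ) (f := f) fun _ _ => Finset.mem_coe.2 (Finset.mem_univ _)
  simp only [AddMonoidHom.card_fiber_eq_of_mem_range f (hsurj _) (hsurj c)] at hsum
  rw [← Finset.card_univ (α := V), hsum, Finset.sum_const, Finset.card_univ, smul_eq_mul]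

theorem sum_comp_linearForm_eq_zero {M : Type*} [AddCommGroup M] [Module k M]
    (hV : Fintype.card k ^ 2 ∣ Fintype.card V) (f : V →ₗ[k] k) (φ : k → M) :
    ∑ v, φ (f v) = 0 := by
  classical
  have nsmul_eq_zero : ∀ {n : ℕ}, Fintype.card k ∣ n → ∀ x : M, n • x = 0 := by
    rintro _ ⟨n, rfl⟩ x
    rw [← Nat.cast_smul_eq_nsmul k, Nat.cast_mul, FiniteField.cast_card_eq_zero, zero_mul,
      zero_smul]
  by_cases hf : f = 0
  · simp [hf, nsmul_eq_zero ((dvd_pow_self _ two_ne_zero).trans hV)]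
  rw [← Finset.sum_fiberwise_of_maps_to (t := Finset.univ) (g := f) fun _ _ => Finset.mem_univ _]
  refine Finset.sum_eq_zero fun c _ => ?_
  rw [Finset.sum_congr rfl fun v hv => congrArg φ (Finset.mem_filter.1 hv).2, Finset.sum_const]
  refine nsmul_eq_zero ((Nat.mul_dvd_mul_iff_left (Fintype.card_pos (α := k))).1 ?_) _
  rwa [card_mul_card_fiber hf, ← pow_two]

end LinearForms

section Powers

theorem card_filter_pow_eq {G : Type*} [CommGroup G] [IsCyclic G] [Fintype G] [DecidableEq G]
    {d e : ℕ} (hG : Fintype.card G = d * e) {y : G} (hy : y ^ e = 1) :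
    (Finset.univ.filter fun x : G => x ^ d = y).card = d := by
  have hpos : 0 < d * e := hG ▸ Fintype.card_pos
  have range_eq_ker : (powMonoidHom d : G →* G).range = (powMonoidHom e).ker := by
    refine Subgroup.eq_of_le_of_card_ge ?_ ?_
    · rintro _ ⟨x, rfl⟩
      simp [MonoidHom.mem_ker, ← pow_mul, ← hG]
    · rw [IsCyclic.card_powMonoidHom_range, IsCyclic.card_powMonoidHom_ker,
        Nat.card_eq_fintype_card, hG, Nat.gcd_mul_left_left, Nat.gcd_mul_right_left,
        Nat.mul_div_cancel_left _ (Nat.pos_of_mul_pos_right hpos)]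
  have hmem : y ∈ (powMonoidHom d : G →* G).range := range_eq_ker ▸ hy
  have hker := IsCyclic.card_powMonoidHom_ker G d
  rw [Nat.card_eq_fintype_card, Nat.card_eq_fintype_card, hG, Nat.gcd_mul_right_left] at hker
  simp only [Fintype.card_subtype, MonoidHom.mem_ker] at hker
  exact (MonoidHom.card_fiber_eq_of_mem_range (powMonoidHom d : G →* G) hmem
    ⟨1, one_pow d⟩).trans hker

theorem card_filter_pow_eq₀ {K : Type*} [Field K] [Fintype K] [DecidableEq K] {d e : ℕ}
    (hK : Fintype.card K = d * e + 1) {y : K} (hy : y ^ e = 1) :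
    (Finset.univ.filter fun x : K => x ^ d = y).card = d := by
  have hunits : Fintype.card Kˣ = d * e := by rw [Fintype.card_units, hK, Nat.add_sub_cancel]
  obtain ⟨hd, he⟩ : d ≠ 0 ∧ e ≠ 0 := mul_ne_zero_iff.1 (hunits ▸ Fintype.card_ne_zero)
  have hy0 : y ≠ 0 := by
    rintro rfl
    simp [he] at hy
  refine .trans (.symm ?_)
    (card_filter_pow_eq hunits (y := Units.mk0 y hy0) (Units.ext (by simpa using hy)))
  refine Finset.card_bij (fun x _ => (x : K)) (fun x hx => ?_) (fun x _ x' _ h => Units.ext h)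
    fun x hx => ?_
  · simpa [Units.ext_iff] using hx
  · have hx0 : x ≠ 0 := by
      rintro rfl
      simp [hd, hy0.symm] at hx
    exact ⟨Units.mk0 x hx0, by simpa [Units.ext_iff] using hx, rfl⟩

end Powers

theorem finrank_eq_of_card_eq {k V : Type*} [Field k] [Fintype k] [AddCommGroup V] [Module k V]
    [Fintype V] {n : ℕ} (hV : Fintype.card V = Fintype.card k ^ n) : Module.finrank k V = n :=
  Nat.pow_right_injective Fintype.one_lt_card ((Module.card_eq_pow_finrank (K := k)).symm.trans hV)

section TraceCodes

variable (k : Type*) {P L E : Type*} [Field k] [Field L] [Algebra k L] [Field E] [Algebra k E]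

/-- The trace code of `φ`: the words `(Tr_{L/k}(a φ(t)))_t` with `a ∈ L`. -/
noncomputable def traceCode (φ : P → L) : Submodule k (P → k) :=
  LinearMap.range (LinearMap.pi fun t => Algebra.trace k L ∘ₗ LinearMap.mulRight k (φ t))

variable {k}

theorem mem_traceCode {φ : P → L} {c : P → k} :
    c ∈ traceCode k φ ↔ ∃ a, (fun t => Algebra.trace k L (a * φ t)) = c := Iff.rfl

theorem trace_mul_mem_traceCode (a : L) (φ : P → L) :
    (fun t => Algebra.trace k L (a * φ t)) ∈ traceCode k φ := ⟨a, rfl⟩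

theorem mem_iSup_traceCode {n : ℕ} {φ : Fin n → P → L} {c : P → k} :
    c ∈ ⨆ i, traceCode k (φ i) ↔
      ∃ b : Fin n → L, (fun t => ∑ i, Algebra.trace k L (b i * φ i t)) = c := by
  have sum_apply : ∀ b : Fin n → L, (fun t => ∑ i, Algebra.trace k L (b i * φ i t)) =
      ∑ i, fun t => Algebra.trace k L (b i * φ i t) := fun b => by
    funext t
    rw [Finset.sum_apply]
  constructor
  · intro hc
    obtain ⟨f, hf, rfl⟩ := (Submodule.mem_iSup_iff_exists_finsupp _ _).1 hc
    choose b hb using hf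
    refine ⟨b, ?_⟩
    rw [sum_apply, Finsupp.sum_fintype _ _ fun _ => rfl]
    exact Finset.sum_congr rfl fun i _ => hb i
  · rintro ⟨b, rfl⟩
    exact sum_apply b ▸
      sum_mem fun i _ => Submodule.mem_iSup_of_mem i (trace_mul_mem_traceCode _ _)

variable [Fintype k]

theorem card_mul_card_trace_mul_fiber [DecidableEq k] [Fintype L] {a : L} (ha : a ≠ 0) (c : k) :
    Fintype.card k * (Finset.univ.filter fun x => Algebra.trace k L (a * x) = c).card =
      Fintype.card L := by
  refine card_mul_card_fiber (f := Algebra.trace k L ∘ₗ LinearMap.mulLeft k a) (fun h => ?_) c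
  obtain ⟨y, hy⟩ := Algebra.trace_surjective k L 1
  simpa [ha, hy] using LinearMap.congr_fun h (a⁻¹ * y)

theorem trace_pow_card_pow [Finite L] (x : L) (i : ℕ) :
    Algebra.trace k L (x ^ Fintype.card k ^ i) = Algebra.trace k L x := by
  induction i with
  | zero => simp
  | succ i ih =>
    rw [← ih, pow_succ, pow_mul]
    exact Algebra.trace_eq_of_algEquiv (FiniteField.frobeniusAlgEquivOfAlgebraic k L) _

theorem sum_units_hom_mul_hom_inv {R : Type*} [CommRing R] [IsDomain R] [Fintype L] [DecidableEq L]
    (σ τ : L →+* R) [Decidable (σ = τ)] :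
    ∑ a : Lˣ, σ a * τ (a : L)⁻¹ = if σ = τ then -1 else 0 := by
  let χ : Lˣ →* R := (σ : L →* R).comp (Units.coeHom L) *
    (τ : L →* R).comp ((Units.coeHom L).comp (MulEquiv.inv Lˣ).toMonoidHom)
  have χ_apply : ∀ a : Lˣ, χ a = σ a * τ (a : L)⁻¹ := fun a => by simp [χ]
  have τ_mul_inv : ∀ a : Lˣ, τ a * τ (a : L)⁻¹ = 1 := fun a => by rw [← map_mul]; simp
  simp_rw [← χ_apply]
  split_ifs with h
  · have χ_eq_one : ∀ a, χ a = 1 := fun a => by rw [χ_apply, h, τ_mul_inv]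
    have card_eq_zero : (Fintype.card L : R) = 0 := by
      rw [← map_natCast σ, FiniteField.cast_card_eq_zero, map_zero]
    rw [Fintype.card_eq_card_units_add_one, Nat.cast_add, Nat.cast_one] at card_eq_zero
    simp [χ_eq_one, eq_neg_of_add_eq_zero_left card_eq_zero]
  · refine sum_hom_units_eq_zero χ fun hχ => h (RingHom.ext fun x => ?_)
    obtain rfl | hx := eq_or_ne x 0
    · simp
    have hone : σ x * τ x⁻¹ = 1 := by
      rw [← Units.val_mk0 hx, ← χ_apply, hχ, MonoidHom.one_apply]
    have := τ_mul_inv (Units.mk0 x hx)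
    rw [Units.val_mk0] at this
    exact mul_right_cancel₀ (right_ne_zero_of_mul_eq_one hone) (hone.trans this.symm)

theorem sum_units_pow_card_pow_mul_inv [Fintype L] [DecidableEq L] {n : ℕ}
    (hn : Module.finrank k L = n) (i j : Fin n) :
    ∑ a : Lˣ, (a : L) ^ Fintype.card k ^ (j : ℕ) * ((a : L)⁻¹) ^ Fintype.card k ^ (i : ℕ) =
      if j = i then -1 else 0 := by
  classical
  subst hn
  have frob_pow : ∀ (i : ℕ) (x : L),
      (FiniteField.frobeniusAlgHom k L ^ i : L →ₐ[k] L).toRingHom x = x ^ Fintype.card k ^ i :=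
    fun i x => by simp [AlgHom.coe_pow, FiniteField.coe_frobeniusAlgHom, pow_iterate]
  have frob_inj : (FiniteField.frobeniusAlgHom k L ^ (j : ℕ) : L →ₐ[k] L).toRingHom =
      (FiniteField.frobeniusAlgHom k L ^ (i : ℕ) : L →ₐ[k] L).toRingHom ↔ j = i :=
    (AlgHom.coe_ringHom_injective.eq_iff).trans
      (FiniteField.bijective_frobeniusAlgHom_pow k L).1.eq_iff
  have := sum_units_hom_mul_hom_inv
    (FiniteField.frobeniusAlgHom k L ^ (j : ℕ) : L →ₐ[k] L).toRingHom
    (FiniteField.frobeniusAlgHom k L ^ (i : ℕ) : L →ₐ[k] L).toRingHom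
  simpa only [frob_pow, frob_inj] using this

variable [Algebra L E] [IsScalarTower k L E]

theorem trace_mul_trace [Finite L] {n : ℕ} (hn : Module.finrank k L = n) (x : L) (y : E) :
    Algebra.trace k L x * Algebra.trace k E y =
      ∑ i : Fin n, Algebra.trace k E (algebraMap L E (x ^ Fintype.card k ^ (i : ℕ)) * y) := by
  rw [← smul_eq_mul, ← map_smul, Algebra.smul_def, IsScalarTower.algebraMap_apply k L E,
    FiniteField.algebraMap_trace_eq_sum_pow, hn, Finset.sum_range, map_sum, Finset.sum_mul,
    map_sum, Nat.card_eq_fintype_card]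

theorem sum_units_trace_mul_trace [Fintype L] [DecidableEq L] {n : ℕ}
    (hn : Module.finrank k L = n) (i : Fin n) (x : L) (b y : E) :
    ∑ a : Lˣ, Algebra.trace k L (a * x) *
        Algebra.trace k E (b * algebraMap L E ((a : L)⁻¹ ^ Fintype.card k ^ (i : ℕ)) * y) =
      -Algebra.trace k E (b * (algebraMap L E (x ^ Fintype.card k ^ (i : ℕ)) * y)) := by
  have sum_units : ∀ j : Fin n, ∑ a : Lˣ, Algebra.trace k E
      (algebraMap L E ((a * x) ^ Fintype.card k ^ (j : ℕ)) *
        (b * algebraMap L E ((a : L)⁻¹ ^ Fintype.card k ^ (i : ℕ)) * y)) =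
      if j = i then -Algebra.trace k E (b * (algebraMap L E (x ^ Fintype.card k ^ (i : ℕ)) * y))
        else 0 := by
    intro j
    have factor : ∀ a : Lˣ, algebraMap L E ((a * x) ^ Fintype.card k ^ (j : ℕ)) *
        (b * algebraMap L E ((a : L)⁻¹ ^ Fintype.card k ^ (i : ℕ)) * y) =
        algebraMap L E
          ((a : L) ^ Fintype.card k ^ (j : ℕ) * (a : L)⁻¹ ^ Fintype.card k ^ (i : ℕ)) *
          (b * (algebraMap L E (x ^ Fintype.card k ^ (j : ℕ)) * y)) := fun a => by
      rw [mul_pow, map_mul, map_mul]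
      ring
    simp_rw [factor]
    rw [← map_sum, ← Finset.sum_mul, ← map_sum, sum_units_pow_card_pow_mul_inv hn]
    split_ifs with h
    · simp [h]
    · simp
  simp_rw [trace_mul_trace hn]
  rw [Finset.sum_comm, Finset.sum_congr rfl fun j _ => sum_units j]
  simp only [Finset.sum_ite_eq', Finset.mem_univ, if_true]

theorem traceCode_mul_traceCode [Finite L] {n : ℕ} (hn : Module.finrank k L = n) (φ : P → L)
    (ψ : P → E) :
    traceCode k φ * traceCode k ψ =
      ⨆ i : Fin n, traceCode k fun t => algebraMap L E (φ t ^ Fintype.card k ^ (i : ℕ)) * ψ t := by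
  refine le_antisymm (Submodule.mul_le.2 ?_) (iSup_le fun i => ?_)
  · rintro _ ⟨a, rfl⟩ _ ⟨b, rfl⟩
    have expand : ((fun t => Algebra.trace k L (a * φ t)) * fun t => Algebra.trace k E (b * ψ t)) =
        ∑ i : Fin n, fun t => Algebra.trace k E (algebraMap L E (a ^ Fintype.card k ^ (i : ℕ)) * b *
          (algebraMap L E (φ t ^ Fintype.card k ^ (i : ℕ)) * ψ t)) := by
      funext t
      simp only [Pi.mul_apply, trace_mul_trace hn, Finset.sum_apply, mul_pow, map_mul,
        mul_assoc, mul_left_comm b]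
    exact expand ▸ sum_mem fun i _ => Submodule.mem_iSup_of_mem i (trace_mul_mem_traceCode _ _)
  · classical
    have := Fintype.ofFinite L
    intro c hc
    obtain ⟨b, rfl⟩ := mem_traceCode.1 hc
    have extract : (fun t => Algebra.trace k E
        (b * (algebraMap L E (φ t ^ Fintype.card k ^ (i : ℕ)) * ψ t))) =
        -∑ a : Lˣ, (fun t => Algebra.trace k L (a * φ t)) * fun t => Algebra.trace k E
          (b * algebraMap L E ((a : L)⁻¹ ^ Fintype.card k ^ (i : ℕ)) * ψ t) := by
      funext t
      rw [Pi.neg_apply, Finset.sum_apply, eq_neg_iff_add_eq_zero, ← neg_eq_iff_add_eq_zero]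
      exact (sum_units_trace_mul_trace hn i (φ t) b (ψ t)).symm
    rw [extract]
    exact neg_mem (sum_mem fun a _ => Submodule.mul_mem_mul
      (trace_mul_mem_traceCode _ _) (trace_mul_mem_traceCode _ _))

end TraceCodes

/-! ### The weights of `𝒞(2m,3)` -/

section HermitianCode

theorem three_pow_two_mul (m : ℕ) : 3 ^ (2 * m) = (3 ^ m + 1) * (3 ^ m - 1) + 1 := by
  rw [← Nat.sq_sub_sq, one_pow, ← pow_mul, mul_comm m,
    Nat.sub_add_cancel (Nat.one_le_pow _ _ (by norm_num))]

theorem pow_three_pow_pow_three_pow {K : Type*} [Field K] [Fintype K] {m : ℕ}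
    (hK : Fintype.card K = 3 ^ (2 * m)) (t : K) : (t ^ 3 ^ m) ^ 3 ^ m = t := by
  rw [← pow_mul, ← pow_add, ← two_mul, ← hK, FiniteField.pow_card]

variable {K : Type*} [Field K] [Algebra (ZMod 3) K] {m : ℕ}

theorem pow_three_pow_sub_one {y : halfField K m} (hy : y ≠ 0) : (y : K) ^ (3 ^ m - 1) = 1 := by
  have hy' : (y : K) ≠ 0 := fun h => hy (Subtype.ext h)
  refine mul_right_cancel₀ hy' ?_
  rw [← pow_succ, Nat.sub_add_cancel (Nat.one_le_pow _ _ (by norm_num)), one_mul]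
  exact y.2

theorem hermitianWord_mem (a : halfField K m) (b : K) (h : ZMod 3) :
    hermitianWord m a b h ∈ hermitianCode K m := ⟨a, b, h, rfl⟩

theorem hermitianWord_add (a a' : halfField K m) (b b' : K) (h h' : ZMod 3) :
    hermitianWord m a b h + hermitianWord m a' b' h' =
      hermitianWord m (a + a') (b + b') (h + h') := by
  funext t
  simp only [hermitianWord, Pi.add_apply, IntermediateField.coe_add, add_mul, map_add]
  ring

variable [Fintype K]

/-- The norm `t ↦ t ^ (3 ^ m + 1)` from `𝔽_{3^{2m}}` onto `𝔽_{3^m}`. -/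
def halfNorm (hK : Fintype.card K = 3 ^ (2 * m)) (t : K) : halfField K m :=
  ⟨t ^ (3 ^ m + 1), by simpa using pow_mem_halfField hK t 1⟩

noncomputable instance : Fintype (halfField K m) := Fintype.ofFinite _

theorem card_halfField (hK : Fintype.card K = 3 ^ (2 * m)) :
    Fintype.card (halfField K m) = 3 ^ m := by
  classical
  obtain ⟨n, hn⟩ : ∃ n, 3 ^ m = n + 1 := Nat.exists_eq_succ_of_ne_zero (by positivity)
  have hK' : Fintype.card K = n * (3 ^ m + 1) + 1 := by
    rw [hK, three_pow_two_mul, hn, Nat.add_sub_cancel, mul_comm]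
  have hn0 : n ≠ 0 := by
    rintro rfl
    exact Fintype.one_lt_card.ne' (hK'.trans (by rw [zero_mul]))
  have mem_iff : ∀ x : K, x ∈ halfField K m ↔
      x ∈ insert 0 (Finset.univ.filter fun x : K => x ^ n = 1) := fun x => by
    change x ^ 3 ^ m = x ↔ _
    rw [hn, pow_succ, mul_left_eq_self₀, or_comm, Finset.mem_insert, Finset.mem_filter,
      and_iff_right (Finset.mem_univ _)]
  rw [Fintype.card_congr (Equiv.subtypeEquivRight mem_iff), Fintype.card_coe,
    Finset.card_insert_of_notMem (by simp [hn0]), card_filter_pow_eq₀ hK' (one_pow _), hn]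

theorem card_filter_halfNorm (hK : Fintype.card K = 3 ^ (2 * m)) (p : halfField K m → Prop)
    [DecidablePred p] (hp : ¬ p 0) :
    (Finset.univ.filter fun t => p (halfNorm hK t)).card =
      (Finset.univ.filter p).card * (3 ^ m + 1) := by
  classical
  rw [Finset.card_eq_sum_card_fiberwise (f := halfNorm hK) (t := Finset.univ.filter p)
    fun t ht => by simpa using ht]
  refine Finset.sum_const_nat fun y hy => ?_
  have hpy : p y := (Finset.mem_filter.1 hy).2
  rw [← card_filter_pow_eq₀ (hK.trans (three_pow_two_mul m))
    (pow_three_pow_sub_one fun h : y = 0 => hp (h ▸ hpy))]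
  congr 1
  ext t
  have norm_eq_iff : halfNorm hK t = y ↔ t ^ (3 ^ m + 1) = (y : K) := Subtype.ext_iff
  simp only [Finset.mem_filter, Finset.mem_univ, true_and, ← norm_eq_iff]
  exact ⟨And.right, fun h => ⟨h ▸ hpy, h⟩⟩

theorem trace_coe_halfField (hK : Fintype.card K = 3 ^ (2 * m)) (y : halfField K m) :
    Algebra.trace (ZMod 3) K (y : K) = -Algebra.trace (ZMod 3) (halfField K m) y := by
  have finrank_eq_two : Module.finrank (halfField K m) K = 2 :=
    finrank_eq_of_card_eq (by rw [card_halfField hK, hK, ← pow_mul, mul_comm])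
  have trace_eq : Algebra.trace (halfField K m) K (y : K) = 2 • y :=
    finrank_eq_two ▸ Algebra.trace_algebraMap y
  have two_smul_eq_neg : ∀ x : ZMod 3, 2 • x = -x := by decide
  rw [← Algebra.trace_trace (S := halfField K m), trace_eq, map_nsmul, two_smul_eq_neg]

theorem hermitianWord_apply (hK : Fintype.card K = 3 ^ (2 * m)) (a : halfField K m) (b : K)
    (h : ZMod 3) (t : K) :
    hermitianWord m a b h t = -Algebra.trace (ZMod 3) (halfField K m) (a * halfNorm hK t) +
      Algebra.trace (ZMod 3) K (b * t) + h := by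
  rw [← trace_coe_halfField hK, ← map_add]
  rfl

theorem hermitianWord_mul_left (hK : Fintype.card K = 3 ^ (2 * m)) (a : halfField K m) (b : K)
    (h : ZMod 3) (s t : K) :
    hermitianWord m a b h (s * t) = hermitianWord m (a * halfNorm hK s) (b * s) h t := by
  simp only [hermitianWord, halfNorm, MulMemClass.coe_mul, mul_pow, mul_assoc]

theorem hermitianWord_add_right (hK : Fintype.card K = 3 ^ (2 * m)) (a : halfField K m) (b : K)
    (h : ZMod 3) (s t : K) :
    hermitianWord m a b h (t + s) =
      hermitianWord m a (b - a * s ^ 3 ^ m) (hermitianWord m a b h s) t := by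
  have := charP_three K
  have ha : (a : K) ^ 3 ^ m = a := a.2
  have cross_term : Algebra.trace (ZMod 3) K (a * t ^ 3 ^ m * s) =
      Algebra.trace (ZMod 3) K (a * s ^ 3 ^ m * t) := by
    rw [← trace_pow_card_pow _ m, ZMod.card, mul_pow, mul_pow, ha,
      pow_three_pow_pow_three_pow hK, mul_right_comm]
  have expand : (a : K) * (t + s) ^ (3 ^ m + 1) + b * (t + s) =
      a * t ^ (3 ^ m + 1) + a * t ^ 3 ^ m * s + a * s ^ 3 ^ m * t + b * t +
        (a * s ^ (3 ^ m + 1) + b * s) := by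
    rw [pow_succ, add_pow_char_pow]
    ring
  have add_self : ∀ x : ZMod 3, x + x = -x := by decide
  simp only [hermitianWord, expand, map_add, cross_term, sub_mul, map_sub]
  linear_combination add_self (Algebra.trace (ZMod 3) K (a * s ^ 3 ^ m * t))

theorem affineInvariant_hermitianCode (hK : Fintype.card K = 3 ^ (2 * m)) :
    AffineInvariant (hermitianCode K m) := by
  rintro s₁ s₂ - _ ⟨a, b, h, rfl⟩
  simp only [hermitianWord_add_right hK, hermitianWord_mul_left hK]
  exact hermitianWord_mem _ _ _

theorem exists_hermitianWord_eq_comp_addRight (hK : Fintype.card K = 3 ^ (2 * m))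
    {a : halfField K m} (ha : a ≠ 0) (b : K) :
    ∃ (s : K) (h₀ : ZMod 3), ∀ h,
      hermitianWord m a b h = hermitianWord m a 0 (h - h₀) ∘ Equiv.addRight s := by
  have ha' : (a : K) ≠ 0 := fun h => ha (Subtype.ext h)
  -- Completing the square: the shift `s` solves `-a s^{3^m} = b`.
  refine ⟨(-b / a) ^ 3 ^ m, hermitianWord m a 0 0 ((-b / a) ^ 3 ^ m), fun h => funext fun t => ?_⟩
  rw [Function.comp_apply, Equiv.coe_addRight, hermitianWord_add_right hK,
    pow_three_pow_pow_three_pow hK, mul_div_cancel₀ _ ha', zero_sub, neg_neg]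
  congr 1
  simp only [hermitianWord]
  ring

section Weights

variable (hK : Fintype.card K = 3 ^ (2 * m)) {a : halfField K m} {b : K} {h : ZMod 3}
include hK

theorem three_mul_hammingNorm_hermitianWord_add (ha : a ≠ 0) (hh : h ≠ 0) :
    3 * hammingNorm (hermitianWord m a 0 h) + 3 ^ m = 2 * 3 ^ (2 * m) := by
  have zeros := card_filter_halfNorm hK
    (fun y => Algebra.trace (ZMod 3) (halfField K m) (a * y) = h) (by simpa using hh.symm)
  have fiber := card_mul_card_trace_mul_fiber (k := ZMod 3) ha h
  have total := hammingNorm_add_card_zeros (hermitianWord m a 0 h)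
  have zero_iff : ∀ t, hermitianWord m a 0 h t = 0 ↔
      Algebra.trace (ZMod 3) (halfField K m) (a * halfNorm hK t) = h := fun t => by
    rw [hermitianWord_apply hK, zero_mul, map_zero, add_zero, neg_add_eq_zero]
  simp only [zero_iff, zeros, hK] at total
  rw [ZMod.card, card_halfField hK] at fiber
  rw [pow_mul'] at total ⊢
  linear_combination 3 * total - (3 ^ m + 1) * fiber

theorem three_mul_hammingNorm_hermitianWord_zero (ha : a ≠ 0) :
    3 * hammingNorm (hermitianWord m a 0 0) = 2 * (3 ^ (2 * m) + 3 ^ m) := by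
  have nonzeros := card_filter_halfNorm hK
    (fun y => Algebra.trace (ZMod 3) (halfField K m) (a * y) ≠ 0) (by simp)
  have fiber := card_mul_card_trace_mul_fiber (k := ZMod 3) ha 0
  have total : _ + (Finset.univ.filter fun y =>
      Algebra.trace (ZMod 3) (halfField K m) (a * y) ≠ 0).card = _ :=
    Finset.card_filter_add_card_filter_not (s := Finset.univ)
      fun y => Algebra.trace (ZMod 3) (halfField K m) (a * y) = 0
  have norm_eq : hammingNorm (hermitianWord m a 0 0) = (Finset.univ.filter fun t =>
      Algebra.trace (ZMod 3) (halfField K m) (a * halfNorm hK t) ≠ 0).card := by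
    simp [hammingNorm, hermitianWord_apply hK]
  rw [ZMod.card, card_halfField hK] at fiber
  rw [Finset.card_univ, card_halfField hK] at total
  rw [norm_eq, nonzeros, pow_mul']
  linear_combination (3 ^ m + 1) * (3 * total - fiber)

theorem exists_three_mul_hammingNorm_hermitianWord (ha : a ≠ 0) (b : K) :
    ∃ h₀, 3 * hammingNorm (hermitianWord m a b h₀) = 2 * (3 ^ (2 * m) + 3 ^ m) ∧
      ∀ h ≠ h₀, 3 * hammingNorm (hermitianWord m a b h) + 3 ^ m = 2 * 3 ^ (2 * m) := by
  obtain ⟨s, h₀, hs⟩ := exists_hermitianWord_eq_comp_addRight hK ha b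
  refine ⟨h₀, ?_, fun h hh => ?_⟩
  · rw [hs, hammingNorm_comp_perm, sub_self, three_mul_hammingNorm_hermitianWord_zero hK ha]
  · rw [hs, hammingNorm_comp_perm,
      three_mul_hammingNorm_hermitianWord_add hK ha (sub_ne_zero.2 hh)]

theorem three_mul_hammingNorm_hermitianWord_linear (hb : b ≠ 0) (h : ZMod 3) :
    3 * hammingNorm (hermitianWord m 0 b h) = 2 * 3 ^ (2 * m) := by
  have fiber := card_mul_card_trace_mul_fiber (k := ZMod 3) hb (-h)
  have total := hammingNorm_add_card_zeros (hermitianWord m 0 b h)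
  have zero_iff : ∀ t, hermitianWord m 0 b h t = 0 ↔
      Algebra.trace (ZMod 3) K (b * t) = -h := fun t => by
    simp [hermitianWord, eq_neg_iff_add_eq_zero]
  simp only [zero_iff, hK] at total
  rw [ZMod.card, hK] at fiber
  omega

theorem hammingNorm_hermitianWord_const (hh : h ≠ 0) :
    hammingNorm (hermitianWord (K := K) m 0 0 h) = 3 ^ (2 * m) := by
  simp [hammingNorm, hermitianWord, hh, hK]

theorem le_three_mul_hammingNorm_of_mem {c : K → ZMod 3} (hc : c ∈ hermitianCode K m)
    (hc0 : c ≠ 0) : 2 * 3 ^ (2 * m) ≤ 3 * hammingNorm c + 3 ^ m := by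
  obtain ⟨a, b, h, rfl⟩ := hc
  obtain rfl | ha := eq_or_ne a 0
  · obtain rfl | hb := eq_or_ne b 0
    · have hh : h ≠ 0 := by
        rintro rfl
        exact hc0 (by funext t; simp [hermitianWord])
      rw [hammingNorm_hermitianWord_const hK hh]
      exact Nat.le_add_right_of_le (Nat.mul_le_mul_right _ (by norm_num))
    · rw [three_mul_hammingNorm_hermitianWord_linear hK hb]
      exact Nat.le_add_right _ _
  · obtain ⟨h₀, hzero, hne⟩ := exists_three_mul_hammingNorm_hermitianWord hK ha b
    obtain rfl | hh := eq_or_ne h h₀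
    · rw [hzero, mul_add, add_assoc]
      exact Nat.le_add_right _ _
    · exact (hne h hh).ge

theorem three_mul_minWeight_hermitianCode_add :
    3 * minWeight (hermitianCode K m) + 3 ^ m = 2 * 3 ^ (2 * m) := by
  have weight_eq := three_mul_hammingNorm_hermitianWord_add hK (one_ne_zero (α := halfField K m))
    (one_ne_zero (α := ZMod 3))
  have isLeast : IsLeast {w | ∃ c ∈ hermitianCode K m, c ≠ 0 ∧ hammingNorm c = w}
      (hammingNorm (hermitianWord m (1 : halfField K m) 0 1)) := by
    refine ⟨⟨_, hermitianWord_mem _ _ _, fun h0 => ?_, rfl⟩, ?_⟩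
    · have : hermitianWord m (1 : halfField K m) 0 1 0 = 1 := by simp [hermitianWord]
      rw [h0] at this
      exact zero_ne_one this
    · rintro _ ⟨c, hc, hc0, rfl⟩
      have := le_three_mul_hammingNorm_of_mem hK hc hc0
      omega
  rw [minWeight, isLeast.csInf_eq, weight_eq]

theorem hammingNorm_eq_minWeight_hermitianCode_iff {c : K → ZMod 3} :
    hammingNorm c = minWeight (hermitianCode K m) ↔
      3 * hammingNorm c + 3 ^ m = 2 * 3 ^ (2 * m) := by
  have := three_mul_minWeight_hermitianCode_add hK
  omega

theorem three_dvd_minWeight_hermitianCode (hm : 2 ≤ m) :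
    3 ∣ minWeight (hermitianCode K m) := by
  have hweight := three_mul_minWeight_hermitianCode_add hK
  have h9 : 3 ^ 2 ∣ 3 ^ m := pow_dvd_pow 3 hm
  have h9' : 3 ^ 2 ∣ 3 ^ (2 * m) := pow_dvd_pow 3 (by omega)
  omega

theorem minWeight_hermitianCode_pos : 0 < minWeight (hermitianCode K m) := by
  have hweight := three_mul_minWeight_hermitianCode_add hK
  have hle : 3 ^ m ≤ 3 ^ (2 * m) := Nat.pow_le_pow_right (by norm_num) (by omega)
  have hpos : 0 < 3 ^ m := by positivity
  omega

end Weights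

end HermitianCode

/-! ### The componentwise square of `𝒞(2m,3)` -/

theorem add_add_one_mul_self {R : Type*} [IdemCommSemiring R] {a b : R} (h : a ≤ b * b) :
    (a + b + 1) * (a + b + 1) = a * b + b * b + a * a + b + 1 :=
  calc (a + b + 1) * (a + b + 1)
      = (a * b + a * b) + (a + (a + b * b)) + a * a + (b + b) + 1 := by ring
    _ = a * b + b * b + a * a + b + 1 := by
      simp only [add_idem, add_eq_right_iff_le.2 h]

section Square

variable {K : Type*} [Field K] [Algebra (ZMod 3) K] [Fintype K] {m : ℕ}

theorem hermitianCode_eq_traceCode_add (hK : Fintype.card K = 3 ^ (2 * m)) :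
    hermitianCode K m = traceCode (ZMod 3) (halfNorm hK) + traceCode (ZMod 3) (id : K → K) + 1 := by
  have hermitianWord_eq : ∀ (a : halfField K m) (b : K) (h : ZMod 3),
      (fun t => Algebra.trace (ZMod 3) (halfField K m) (a * halfNorm hK t)) +
        (fun t => Algebra.trace (ZMod 3) K (b * id t)) + algebraMap (ZMod 3) (K → ZMod 3) h =
        hermitianWord m (-a) b h := fun a b h => by
    funext t
    simp [hermitianWord_apply hK]
  refine le_antisymm ?_ fun w hw => ?_
  · rintro _ ⟨a, b, h, rfl⟩
    rw [← neg_neg a, ← hermitianWord_eq]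
    exact Submodule.add_mem_sup (Submodule.add_mem_sup (trace_mul_mem_traceCode _ _)
      (trace_mul_mem_traceCode _ _)) (Submodule.algebraMap_mem h)
  · simp only [Submodule.add_eq_sup, Submodule.mem_sup, mem_traceCode, Submodule.mem_one] at hw
    obtain ⟨_, ⟨_, ⟨a, rfl⟩, _, ⟨b, rfl⟩, rfl⟩, _, ⟨h, rfl⟩, rfl⟩ := hw
    exact ⟨-a, b, h, hermitianWord_eq a b h⟩

theorem spanningWord_eq (hK : Fintype.card K = 3 ^ (2 * m)) (b₁ : Fin m → K)
    (b₂ : Fin (2 * m) → K) (c : Fin m → halfField K m) (b : K) (h : ZMod 3) :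
    spanningWord hK b₁ b₂ c b h =
      (fun t => ∑ i : Fin m, Algebra.trace (ZMod 3) K
        (b₁ i * ((halfNorm hK t : K) ^ 3 ^ (i : ℕ) * t))) +
      (fun t => ∑ i : Fin (2 * m), Algebra.trace (ZMod 3) K (b₂ i * (t ^ 3 ^ (i : ℕ) * t))) +
      (fun t => ∑ i : Fin m, Algebra.trace (ZMod 3) (halfField K m)
        (c i * (halfNorm hK t ^ 3 ^ (i : ℕ) * halfNorm hK t))) +
      (fun t => Algebra.trace (ZMod 3) K (b * id t)) +
      algebraMap (ZMod 3) (K → ZMod 3) h := by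
  have pow_mul_self : ∀ (t : K) (i : ℕ), t ^ ((3 ^ m + 1) * 3 ^ i + 1) =
      (halfNorm hK t : K) ^ 3 ^ i * t := fun t i => by
    rw [pow_succ, pow_mul]
    rfl
  have halfNorm_pow_mul_self : ∀ (t : K) (i : ℕ),
      (⟨t ^ ((3 ^ m + 1) * (3 ^ i + 1)), pow_mem_halfField hK t _⟩ : halfField K m) =
        halfNorm hK t ^ 3 ^ i * halfNorm hK t := fun t i => by
    rw [← pow_succ]
    exact Subtype.ext (pow_mul _ _ _)
  funext t
  simp only [spanningWord, pow_mul_self, halfNorm_pow_mul_self, pow_succ t]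
  rfl

theorem span_spanningWord (hK : Fintype.card K = 3 ^ (2 * m)) :
    Submodule.span (ZMod 3) {f | ∃ (b₁ : Fin m → K) (b₂ : Fin (2 * m) → K)
        (c : Fin m → halfField K m) (b : K) (h : ZMod 3), f = spanningWord hK b₁ b₂ c b h} =
      (⨆ i : Fin m, traceCode (ZMod 3) fun t => (halfNorm hK t : K) ^ 3 ^ (i : ℕ) * t) +
      (⨆ i : Fin (2 * m), traceCode (ZMod 3) fun t : K => t ^ 3 ^ (i : ℕ) * t) +
      (⨆ i : Fin m, traceCode (ZMod 3) fun t => halfNorm hK t ^ 3 ^ (i : ℕ) * halfNorm hK t) +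
      traceCode (ZMod 3) (id : K → K) + 1 := by
  refine le_antisymm (Submodule.span_le.2 ?_) fun w hw => ?_
  · rintro _ ⟨b₁, b₂, c, b, h, rfl⟩
    rw [spanningWord_eq]
    exact Submodule.add_mem_sup (Submodule.add_mem_sup (Submodule.add_mem_sup
      (Submodule.add_mem_sup (mem_iSup_traceCode.2 ⟨b₁, rfl⟩) (mem_iSup_traceCode.2 ⟨b₂, rfl⟩))
      (mem_iSup_traceCode.2 ⟨c, rfl⟩)) (trace_mul_mem_traceCode _ _)) (Submodule.algebraMap_mem h)
  · simp only [Submodule.add_eq_sup, Submodule.mem_sup, mem_iSup_traceCode, mem_traceCode,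
      Submodule.mem_one] at hw
    obtain ⟨_, ⟨_, ⟨_, ⟨_, ⟨b₁, rfl⟩, _, ⟨b₂, rfl⟩, rfl⟩, _, ⟨c, rfl⟩, rfl⟩, _, ⟨b, rfl⟩, rfl⟩,
      _, ⟨h, rfl⟩, rfl⟩ := hw
    exact Submodule.subset_span ⟨b₁, b₂, c, b, h, (spanningWord_eq hK b₁ b₂ c b h).symm⟩

theorem hermitianCode_mul_self (hK : Fintype.card K = 3 ^ (2 * m)) :
    hermitianCode K m * hermitianCode K m =
      Submodule.span (ZMod 3) {f | ∃ (b₁ : Fin m → K) (b₂ : Fin (2 * m) → K)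
        (c : Fin m → halfField K m) (b : K) (h : ZMod 3), f = spanningWord hK b₁ b₂ c b h} := by
  have finrank_half : Module.finrank (ZMod 3) (halfField K m) = m :=
    finrank_eq_of_card_eq (by rw [card_halfField hK, ZMod.card])
  have finrank_full : Module.finrank (ZMod 3) K = 2 * m :=
    finrank_eq_of_card_eq (by rw [hK, ZMod.card])
  have traceCode_halfNorm_le : traceCode (ZMod 3) (halfNorm hK) ≤
      traceCode (ZMod 3) (id : K → K) * traceCode (ZMod 3) id := by
    have hm : m < 2 * m := by
      have finrank_pos := Module.finrank_pos (R := ZMod 3) (M := K)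
      omega
    rw [traceCode_mul_traceCode finrank_full]
    rintro _ ⟨a, rfl⟩
    refine Submodule.mem_iSup_of_mem ⟨m, hm⟩ ⟨-a, funext fun t => ?_⟩
    change Algebra.trace (ZMod 3) K (-a * (t ^ Fintype.card (ZMod 3) ^ m * t)) =
      Algebra.trace (ZMod 3) (halfField K m) (a * halfNorm hK t)
    rw [ZMod.card, ← pow_succ, neg_mul, map_neg, neg_eq_iff_eq_neg, ← trace_coe_halfField hK]
    rfl
  rw [hermitianCode_eq_traceCode_add hK, add_add_one_mul_self traceCode_halfNorm_le,
    traceCode_mul_traceCode finrank_half, traceCode_mul_traceCode finrank_half,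
    traceCode_mul_traceCode finrank_full, ZMod.card, span_spanningWord hK]
  rfl

theorem one_mem_designCode_hermitianBlocks (hm : 2 ≤ m) (hK : Fintype.card K = 3 ^ (2 * m)) :
    1 ∈ designCode (hermitianBlocks K m) := by
  classical
  have sum_sq : ∑ a : halfField K m, hermitianWord m a 0 1 * hermitianWord m a 0 1 = 0 := by
    funext t
    have h9 : Fintype.card (ZMod 3) ^ 2 ∣ Fintype.card (halfField K m) := by
      rw [ZMod.card, card_halfField hK]
      exact pow_dvd_pow 3 hm
    simpa [hermitianWord_apply hK] using sum_comp_linearForm_eq_zero h9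
      (Algebra.trace (ZMod 3) (halfField K m) ∘ₗ LinearMap.mulRight (ZMod 3) (halfNorm hK t))
      fun x => (-x + 1) * (-x + 1)
  have word_zero : hermitianWord (K := K) m 0 0 1 = 1 := funext fun t => by simp [hermitianWord]
  rw [← Finset.add_sum_erase _ _ (Finset.mem_univ 0), word_zero, one_mul] at sum_sq
  rw [eq_neg_of_add_eq_zero_left sum_sq]
  refine neg_mem (sum_mem fun a ha => mul_self_mem_designCode (hermitianWord_mem a 0 1) ?_)
  exact (hammingNorm_eq_minWeight_hermitianCode_iff hK).2
    (three_mul_hammingNorm_hermitianWord_add hK (Finset.ne_of_mem_erase ha) one_ne_zero)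

theorem hermitianWord_mul_self_mem_designCode (hm : 2 ≤ m) (hK : Fintype.card K = 3 ^ (2 * m))
    {a : halfField K m} (ha : a ≠ 0) (b : K) (h : ZMod 3) :
    hermitianWord m a b h * hermitianWord m a b h ∈ designCode (hermitianBlocks K m) := by
  obtain ⟨h₀, -, weight⟩ := exists_three_mul_hammingNorm_hermitianWord hK ha b
  have sq_mem : ∀ e ≠ 0, hermitianWord m a b (h₀ + e) * hermitianWord m a b (h₀ + e) ∈
      designCode (hermitianBlocks K m) := fun e he =>
    mul_self_mem_designCode (hermitianWord_mem _ _ _)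
      ((hammingNorm_eq_minWeight_hermitianCode_iff hK).2 (weight _ (by simpa using he)))
  have word_add : ∀ e, hermitianWord m a b (h₀ + e) =
      hermitianWord m a b h₀ + algebraMap (ZMod 3) _ e := fun e =>
    funext fun t => (add_assoc _ _ _).symm
  rw [← add_sub_cancel h₀ h, word_add]
  refine mul_self_add_algebraMap_mem (by decide) (one_mem_designCode_hermitianBlocks hm hK) ?_ ?_ _
  · simpa [word_add] using sq_mem 1 one_ne_zero
  · simpa [word_add, sub_eq_add_neg] using sq_mem (-1) (by decide)

theorem mul_self_mem_designCode_hermitianBlocks (hm : 2 ≤ m) (hK : Fintype.card K = 3 ^ (2 * m))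
    {c : K → ZMod 3} (hc : c ∈ hermitianCode K m) : c * c ∈ designCode (hermitianBlocks K m) := by
  obtain ⟨a, b, h, rfl⟩ := hc
  obtain rfl | ha := eq_or_ne a 0
  · have sq_mem := hermitianWord_mul_self_mem_designCode hm hK (one_ne_zero (α := halfField K m))
    have word_add : hermitianWord m (1 : halfField K m) 0 0 + hermitianWord m 0 b h =
        hermitianWord m 1 b h := by simp [hermitianWord_add]
    have word_sub : hermitianWord m (1 : halfField K m) 0 0 - hermitianWord m 0 b h =
        hermitianWord m 1 (-b) (-h) := by simp [sub_eq_iff_eq_add, hermitianWord_add]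
    exact mul_self_mem_of_parallelogram (by decide) (sq_mem 0 0) (word_add ▸ sq_mem b h)
      (word_sub ▸ sq_mem (-b) (-h))
  · exact hermitianWord_mul_self_mem_designCode hm hK ha b h

theorem designCode_hermitianBlocks (hm : 2 ≤ m) (hK : Fintype.card K = 3 ^ (2 * m)) :
    designCode (hermitianBlocks K m) = hermitianCode K m * hermitianCode K m :=
  (designCode_supportBlocks_le _ _).antisymm
    (mul_self_le_of_forall_mul_self_mem (by decide) fun _ =>
      mul_self_mem_designCode_hermitianBlocks hm hK)

end Square

end HermitianDesign

theorem theorem3p15 (m : ℕ) (hm : 2 ≤ m) (K : Type*) [Field K] [Fintype K]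
    [Algebra (ZMod 3) K] (hK : Fintype.card K = 3 ^ (2 * m)) :
    -- the code `𝒞(2m,3)` is affine-invariant and its minimum-weight supports form a 2-design
    HermitianDesign.AffineInvariant (HermitianDesign.hermitianCode K m) ∧
    (∃ l, HermitianDesign.IsDesign 2
      (HermitianDesign.minWeight (HermitianDesign.hermitianCode K m)) l
      (HermitianDesign.hermitianBlocks K m)) ∧
    -- the ternary code of this design
    HermitianDesign.designCode (HermitianDesign.hermitianBlocks K m) =
      Submodule.span (ZMod 3)
        {f | ∃ (b₁ : Fin m → K) (b₂ : Fin (2 * m) → K)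
          (c : Fin m → HermitianDesign.halfField K m) (b : K) (h : ZMod 3),
          f = HermitianDesign.spanningWord hK b₁ b₂ c b h} ∧
    HermitianDesign.AffineInvariant
      (HermitianDesign.designCode (HermitianDesign.hermitianBlocks K m)) ∧
    HermitianDesign.HoldsDesigns 2
      (HermitianDesign.designCode (HermitianDesign.hermitianBlocks K m)) := by
  open HermitianDesign in
  have hC := affineInvariant_hermitianCode hK
  have hD := designCode_hermitianBlocks hm hK
  have hDinv : AffineInvariant (designCode (hermitianBlocks K m)) := hD ▸ hC.mul hC
  have three_dvd := three_dvd_minWeight_hermitianCode hK hm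
  have two_le : 2 ≤ minWeight (hermitianCode K m) :=
    le_trans (by norm_num) (Nat.le_of_dvd (minWeight_hermitianCode_pos hK) three_dvd)
  have weight := (hammingNorm_eq_minWeight_hermitianCode_iff hK).2
    (three_mul_hammingNorm_hermitianWord_add hK (a := 1) (h := 1) one_ne_zero one_ne_zero)
  refine ⟨hC, hC.exists_isDesign two_le ⟨_, hermitianWord_mem 1 0 1, weight⟩,
    hD.trans (hermitianCode_mul_self hK), hDinv, ?_⟩
  rintro k hk ⟨c, hc, rfl⟩
  have three_dvd_block : ∀ B ∈ hermitianBlocks K m, 3 ∣ B.card := by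
    rintro _ ⟨c, -, hck, rfl⟩
    rwa [card_wordSupport, hck]
  have ne_one := hammingNorm_ne_one_of_sum_eq_zero
    (sum_eq_zero_of_mem_designCode three_dvd_block hc)
  exact hDinv.exists_isDesign (by omega) ⟨c, hc, rfl⟩
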